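/- **Proposition (hypothesis test via the smallest signal eigenvalue $\Lambda_1$).** For $n$ divisible by $3$ let $0<q_n<p_n\le 1$ and $0<\varepsilon_n<p_n-q_n$, and put $$B_0=\begin{pmatrix}p_n&q_n&q_n\\ q_n&p_n&q_n\\ q_n&q_n&p_n\end{pmatrix},\qquad B_{\varepsilon}=\begin{pmatrix}p_n&q_n+\varepsilon_n&q_n\\ q_n+\varepsilon_n&p_n&q_n\\ q_n&q_n&p_n\end{pmatrix}.$$ Let $A$ be the symmetric $0/1$ adjacency matrix of a stochastic block model graph on $n$ vertices (self-loops allowed) with block matrix $B$ and an assignment $z$ of the vertices to three blocks of exactly $n/3$ vertices each: the entries $A_{ij}$, $i\le j$, are independent and $A_{ij}\sim\mathrm{Bernoulli}(B_{z(i)z(j)})$. Consider testing $\mathbb H_0:B=B_0$ against $\mathbb H_A:B=B_{\varepsilon}$ by rejecting $\mathbb H_0$ when $\Lambda_1<\tau_n$, where $\Lambda_1$ is the third largest eigenvalue of $A$ (the smallest of the three signal eigenvalues). Assume that $q_n=\omega(\log n/n)$ and $n\varepsilon_n=\omega(\log n)$ as $n\to\infty$, and that under the null the smallest signal eigenvalue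 $\frac n3(p_n-q_n)$ of the edge probability matrix is at least of the order of the maximum expected degree: there is a constant $c>0$ with $p_n-q_n\ge c\,(p_n+2q_n)$ for all large $n$. Then the test based on $\Lambda_1$ has asymptotically full power: there are critical values $\tau_n$, depending only on the model parameters $(p_n,q_n,\varepsilon_n)_n$ and not on the block assignments, such that for every choice of balanced block assignments, as $n\to\infty$ along multiples of $3$, $$\mathbb P_{\mathbb H_0}(\Lambda_1<\tau_n)\to 0\qquad\text{and}\qquad \mathbb P_{\mathbb H_A}(\Lambda_1<\tau_n)\to 1 .$$ -/

import Mathlib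

open MeasureTheory ProbabilityTheory Filter Topology Asymptotics

noncomputable section

/-- A realization of an undirected graph on `Fin n`, self-loops allowed: one Boolean for every
unordered pair `{i, j}`, including `i = j` (equivalently, for every pair `i ≤ j`). -/
abbrev Graph01 (n : ℕ) : Type := Sym2 (Fin n) → Bool

/-- The symmetric `0/1` adjacency matrix of a realization. -/
def adjacency {n : ℕ} (ω : Graph01 n) : Matrix (Fin n) (Fin n) ℝ :=
  Matrix.of fun i j => if ω s(i, j) = true then 1 else 0

theorem adjacency_isHermitian {n : ℕ} (ω : Graph01 n) : (adjacency ω).IsHermitian := by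
  ext i j
  simp [adjacency, Matrix.conjTranspose_apply, Sym2.eq_swap]

/-- The inhomogeneous Erdős–Rényi law with symmetric edge probability matrix `P`: the entries
`A i j`, `i ≤ j`, are independent and `A i j` is Bernoulli with parameter `P i j`.
The projection to `[0, 1]` is the identity on probabilities. -/
def graphLaw {n : ℕ} (P : Matrix (Fin n) (Fin n) ℝ) : Measure (Graph01 n) :=
  Measure.pi fun e : Sym2 (Fin n) =>
    bernoulliMeasure true false (Set.projIcc (0 : ℝ) 1 zero_le_one (P e.inf e.sup))

/-- Block edge probability matrix of the null model. -/
def blockNull (p q : ℝ) : Matrix (Fin 3) (Fin 3) ℝ :=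
  !![p, q, q;
     q, p, q;
     q, q, p]

/-- Block edge probability matrix of the alternative model. -/
def blockAlt (p q ε : ℝ) : Matrix (Fin 3) (Fin 3) ℝ :=
  !![p, q + ε, q;
     q + ε, p, q;
     q, q, p]

/-- A block assignment of `3 * m` vertices with three blocks of `m` vertices each. -/
def BalancedBlocks {m : ℕ} (z : Fin (3 * m) → Fin 3) : Prop :=
  ∀ k : Fin 3, (Finset.univ.filter fun i => z i = k).card = m

/-- Edge probability matrix of the stochastic block model with block matrix `B` and block
assignment `z`. -/
def edgeProb {n : ℕ} (B : Matrix (Fin 3) (Fin 3) ℝ) (z : Fin n → Fin 3) :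
    Matrix (Fin n) (Fin n) ℝ :=
  Matrix.of fun i j => B (z i) (z j)

/-- The smallest of the three signal eigenvalues of the observed graph, i.e. the third largest
eigenvalue of its adjacency matrix, counted with multiplicity (`eigenvalues₀` lists the eigenvalues
in decreasing order, starting from index `0`). The value for `n < 3` is irrelevant. -/
def smallestSignalEigenvalue {n : ℕ} (ω : Graph01 n) : ℝ :=
  if h : 2 < Fintype.card (Fin n) then (adjacency_isHermitian ω).eigenvalues₀ ⟨2, h⟩ else 0

/-- Rejection region of the test that rejects the null hypothesis when the smallest signal
eigenvalue falls below the critical value `τ`. -/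
def rejectionRegion (n : ℕ) (τ : ℝ) : Set (Graph01 n) :=
  {ω | smallestSignalEigenvalue ω < τ}

end

/-! Write `A = P + E` with `P` the edge probability matrix and `n = 3m`. The third eigenvalue of `P`
is `m(p - q)` under the null and `m(p - q - ε)` under the alternative. Weyl's inequality cannot
detect this gap: the norm of `E` is typically of order `√(np)`, while `nε` need only dominate `log
n`. The noise must therefore be measured along the few directions that matter, and the cut-off is
`m(p - q) - mε/2`.

Null: Courant–Fischer on the span of the block indicators gives a lower bound that involves only the
nine block sums of `E`. Their second moments are `O(m²p)`, so by Chebyshev all are below `m²ε/6`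
once `mε → ∞` (`le_smallestSignalEigenvalue_of_blockNoise`).

Alternative: on vectors orthogonal to the indicators of blocks `0 ∪ 1` and `2`, the form of `P` has
rank one, along the contrast `u` of blocks 0 and 1. For `x = a u + w`, `w ⊥ u`, the noise splits
into `uᵀEu`, a cross term controlled by `|Eu|²`, and `wᵀEw`. The first two need only second moments;
the last needs just `‖E‖ ≲ np`, since `w` lies where the form of `P` vanishes and the signal is at
least of order `np` (`smallestSignalEigenvalue_le_of_noise`).

The crude norm bound is the trace method with exponent `2⌈log n⌉`
(`integral_trace_noiseMatrix_pow_le`). It loses a logarithm against `√(np)`, which `np = ω(log n)`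
absorbs. -/

/-! ### Spectral coordinates, Courant–Fischer and trace bounds. -/

open Matrix in
theorem Matrix.IsHermitian.exists_spectral_coordinates {ι : Type*} [Fintype ι] [DecidableEq ι]
    {A : Matrix ι ι ℝ} (hA : A.IsHermitian) :
    ∃ e : Fin (Fintype.card ι) → ι → ℝ,
      (∀ i j, e i ⬝ᵥ e j = if i = j then 1 else 0) ∧
      (∀ x, x ⬝ᵥ x = ∑ i, (e i ⬝ᵥ x) ^ 2) ∧
      ∀ x, x ⬝ᵥ A *ᵥ x = ∑ i, hA.eigenvalues₀ i * (e i ⬝ᵥ x) ^ 2 := by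
  set σ : Fin (Fintype.card ι) ≃ ι := Fintype.equivOfCardEq (Fintype.card_fin _) with hσ
  set U : Matrix ι ι ℝ := (hA.eigenvectorUnitary : Matrix ι ι ℝ) with hU
  have h1 : Uᵀ * U = 1 := by
    have := (Matrix.mem_unitaryGroup_iff' (A := U)).1 hA.eigenvectorUnitary.2
    simpa [Matrix.star_eq_conjTranspose] using this
  have h2 : U * Uᵀ = 1 := mul_eq_one_comm.1 h1
  have hspec : A = U * diagonal hA.eigenvalues * Uᵀ := by
    have := hA.spectral_theorem
    simpa [Unitary.conjStarAlgAut_apply, Matrix.star_eq_conjTranspose, Function.comp_def] using this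
  have hev (i) : hA.eigenvalues (σ i) = hA.eigenvalues₀ i := by
    simp [Matrix.IsHermitian.eigenvalues, hσ]
  have hquad (d : ι → ℝ) (x : ι → ℝ) :
      x ⬝ᵥ (U * diagonal d * Uᵀ) *ᵥ x = ∑ j, d j * ((Uᵀ j) ⬝ᵥ x) ^ 2 := by
    have : x ⬝ᵥ (U * diagonal d * Uᵀ) *ᵥ x = (Uᵀ *ᵥ x) ⬝ᵥ (diagonal d *ᵥ (Uᵀ *ᵥ x)) := by
      rw [← mulVec_mulVec, ← mulVec_mulVec, dotProduct_mulVec x U, ← mulVec_transpose]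
    rw [this]
    simp only [dotProduct, mulVec_diagonal]
    refine Finset.sum_congr rfl fun j _ => ?_
    simp only [mulVec, dotProduct]
    ring
  refine ⟨fun i => Uᵀ (σ i), fun i j => ?_, fun x => ?_, fun x => ?_⟩
  · have := congrFun (congrFun h1 (σ i)) (σ j)
    simpa [Matrix.mul_apply, dotProduct, Matrix.one_apply] using this
  · have := hquad (fun _ => 1) x
    rw [show diagonal (fun _ : ι => (1 : ℝ)) = 1 from diagonal_one, Matrix.mul_one, h2,
      one_mulVec] at this
    rw [this, ← Equiv.sum_comp σ]
    simp
  · conv_lhs => rw [hspec]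
    rw [hquad, ← Equiv.sum_comp σ]
    simp [hev]

theorem exists_ne_zero_sum_smul_eq_zero (f : Fin 3 → Fin 2 → ℝ) :
    ∃ a : Fin 3 → ℝ, a ≠ 0 ∧ ∀ j, ∑ k, a k * f k j = 0 := by
  have h := LinearMap.ker_ne_bot_of_finrank_lt (f := (Matrix.of f).vecMulLinear) (by simp)
  obtain ⟨a, ha, ha0⟩ := (Submodule.ne_bot_iff _).1 h
  refine ⟨a, ha0, fun j => ?_⟩
  have := congrFun (LinearMap.mem_ker.1 ha) j
  simpa [Matrix.vecMul, dotProduct] using this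

open Matrix in
/-- Courant–Fischer lower bound for the third largest eigenvalue. -/
theorem Matrix.IsHermitian.le_eigenvalues₀_two {ι : Type*} [Fintype ι] [DecidableEq ι]
    {A : Matrix ι ι ℝ} (hA : A.IsHermitian) (h : 2 < Fintype.card ι) (v : Fin 3 → ι → ℝ) (t : ℝ)
    (hv : ∀ a : Fin 3 → ℝ, a ≠ 0 → 0 < (∑ k, a k • v k) ⬝ᵥ (∑ k, a k • v k))
    (hq : ∀ a : Fin 3 → ℝ, t * ((∑ k, a k • v k) ⬝ᵥ (∑ k, a k • v k)) ≤
      (∑ k, a k • v k) ⬝ᵥ A *ᵥ (∑ k, a k • v k)) :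
    t ≤ hA.eigenvalues₀ ⟨2, h⟩ := by
  obtain ⟨e, -, hn, hs⟩ := hA.exists_spectral_coordinates
  -- Dimension count: a three-dimensional span contains a nonzero vector orthogonal to the top two
  -- eigenvectors.
  obtain ⟨a, ha, ha0⟩ := exists_ne_zero_sum_smul_eq_zero
    fun k j => e ⟨j, j.2.trans h⟩ ⬝ᵥ v k
  have hx := hv a ha
  have hxq := hq a
  set x := ∑ k, a k • v k with hxdef
  have horth (j : Fin 2) : e ⟨j, j.2.trans h⟩ ⬝ᵥ x = 0 := by
    rw [← ha0 j, hxdef, dotProduct_sum]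
    simp
  have : x ⬝ᵥ A *ᵥ x ≤ hA.eigenvalues₀ ⟨2, h⟩ * (x ⬝ᵥ x) := by
    rw [hs, hn, Finset.mul_sum]
    refine Finset.sum_le_sum fun i _ => ?_
    by_cases hi : (i : ℕ) < 2
    · have := horth ⟨i, hi⟩
      simp only [Fin.eta] at this
      simp [this]
    · exact mul_le_mul_of_nonneg_right
        (hA.eigenvalues₀_antitone (Fin.mk_le_of_le_val (not_lt.1 hi))) (sq_nonneg _)
  exact le_of_mul_le_mul_right (hxq.trans this) hx

open Matrix in
/-- Courant–Fischer upper bound for the third largest eigenvalue. -/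
theorem Matrix.IsHermitian.eigenvalues₀_two_le {ι : Type*} [Fintype ι] [DecidableEq ι]
    {A : Matrix ι ι ℝ} (hA : A.IsHermitian) (h : 2 < Fintype.card ι) (v : Fin 2 → ι → ℝ) (t : ℝ)
    (hq : ∀ x : ι → ℝ, (∀ j, v j ⬝ᵥ x = 0) → x ⬝ᵥ A *ᵥ x ≤ t * (x ⬝ᵥ x)) :
    hA.eigenvalues₀ ⟨2, h⟩ ≤ t := by
  obtain ⟨e, ho, hn, hs⟩ := hA.exists_spectral_coordinates
  have hk (k : Fin 3) : (k : ℕ) < Fintype.card ι := by omega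
  obtain ⟨a, ha, ha0⟩ := exists_ne_zero_sum_smul_eq_zero fun k j => v j ⬝ᵥ e ⟨k, hk k⟩
  set x := ∑ k, a k • e ⟨k, hk k⟩ with hxdef
  have hcoord (i) : e i ⬝ᵥ x = ∑ k, a k * if i = ⟨k, hk k⟩ then 1 else 0 := by
    rw [hxdef, dotProduct_sum]
    simp [ho]
  have hx : 0 < x ⬝ᵥ x := by
    obtain ⟨k, hk0⟩ := Function.ne_iff.1 ha
    rw [hn]
    refine Finset.sum_pos' (fun _ _ => sq_nonneg _) ⟨⟨k, hk k⟩, Finset.mem_univ _, ?_⟩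
    have : e ⟨k, hk k⟩ ⬝ᵥ x = a k := by
      rw [hcoord]
      simp [Fin.ext_iff]
      simp [← Fin.ext_iff]
    rw [this]
    have : a k ≠ 0 := hk0
    positivity
  have hle : hA.eigenvalues₀ ⟨2, h⟩ * (x ⬝ᵥ x) ≤ x ⬝ᵥ A *ᵥ x := by
    rw [hs, hn, Finset.mul_sum]
    refine Finset.sum_le_sum fun i _ => ?_
    by_cases hi : (i : ℕ) ≤ 2
    · exact mul_le_mul_of_nonneg_right (hA.eigenvalues₀_antitone hi) (sq_nonneg _)
    · have : e i ⬝ᵥ x = 0 := by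
        rw [hcoord]
        refine Finset.sum_eq_zero fun k _ => ?_
        rw [if_neg (by rintro rfl; simp at hi; omega), mul_zero]
      simp [this]
  refine le_of_mul_le_mul_right (hle.trans (hq x fun j => ?_)) hx
  rw [← ha0 j, hxdef, dotProduct_sum]
  simp

open Matrix in
theorem Matrix.IsHermitian.trace_pow_eq_sum_eigenvalues {ι : Type*} [Fintype ι] [DecidableEq ι]
    {A : Matrix ι ι ℝ} (hA : A.IsHermitian) (k : ℕ) :
    (A ^ k).trace = ∑ i, hA.eigenvalues i ^ k := by
  conv_lhs => rw [hA.spectral_theorem, ← map_pow, Unitary.conjStarAlgAut_apply, trace_mul_comm,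
    ← mul_assoc, Unitary.coe_star_mul_self, one_mul, diagonal_pow, trace_diagonal]
  simp

-- An even power makes the trace a sum of nonnegative terms, so it dominates the power of each
-- single eigenvalue.
open Matrix in
theorem Matrix.IsHermitian.dotProduct_mulVec_le_of_trace_pow_le {ι : Type*} [Fintype ι]
    [DecidableEq ι] {A : Matrix ι ι ℝ} (hA : A.IsHermitian) {k : ℕ} (hk : k ≠ 0) {b : ℝ}
    (hb : 0 ≤ b) (h : (A ^ (2 * k)).trace ≤ b ^ (2 * k)) (x : ι → ℝ) :
    x ⬝ᵥ A *ᵥ x ≤ b * (x ⬝ᵥ x) := by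
  obtain ⟨e, -, hn, hs⟩ := hA.exists_spectral_coordinates
  rw [hs, hn, Finset.mul_sum]
  refine Finset.sum_le_sum fun i _ => mul_le_mul_of_nonneg_right ?_ (sq_nonneg _)
  refine le_of_pow_le_pow_left₀ (n := 2 * k) (by omega) hb (le_trans ?_ h)
  rw [hA.trace_pow_eq_sum_eigenvalues]
  have : hA.eigenvalues₀ i = hA.eigenvalues (Fintype.equivOfCardEq (Fintype.card_fin _) i) := by
    simp [Matrix.IsHermitian.eigenvalues]
  rw [this]
  exact Finset.single_le_sum (f := fun j => hA.eigenvalues j ^ (2 * k))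
    (fun j _ => (even_two_mul k).pow_nonneg _) (Finset.mem_univ _)

/-! ### Signal plus noise decomposition. -/

/-- The centred indicator of the edge `e`. -/
noncomputable def edgeNoise {n : ℕ} (P : Matrix (Fin n) (Fin n) ℝ) (ω : Graph01 n)
    (e : Sym2 (Fin n)) : ℝ :=
  (if ω e = true then 1 else 0) - P e.inf e.sup

/-- The noise part of the adjacency matrix. -/
noncomputable def noiseMatrix {n : ℕ} (P : Matrix (Fin n) (Fin n) ℝ) (ω : Graph01 n) :
    Matrix (Fin n) (Fin n) ℝ :=
  Matrix.of fun i j => edgeNoise P ω s(i, j)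

theorem adjacency_eq_add_noiseMatrix {n : ℕ} {P : Matrix (Fin n) (Fin n) ℝ} (hP : P.IsSymm)
    (ω : Graph01 n) : adjacency ω = P + noiseMatrix P ω := by
  ext i j
  have : P (i ⊓ j) (i ⊔ j) = P i j := by
    rcases le_total i j with h | h
    · simp [h]
    · simp [h, hP.apply j i]
  simp [adjacency, noiseMatrix, edgeNoise, this]

theorem noiseMatrix_isHermitian {n : ℕ} (P : Matrix (Fin n) (Fin n) ℝ) (ω : Graph01 n) :
    (noiseMatrix P ω).IsHermitian := by
  ext i j
  simp [noiseMatrix, Matrix.conjTranspose_apply, Sym2.eq_swap]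

instance {n : ℕ} (P : Matrix (Fin n) (Fin n) ℝ) : IsProbabilityMeasure (graphLaw P) := by
  unfold graphLaw; infer_instance

theorem integrable_graphLaw {n : ℕ} (P : Matrix (Fin n) (Fin n) ℝ) (f : Graph01 n → ℝ) :
    Integrable f (graphLaw P) := .of_finite

/-! ### Moments of the noise. -/

section Moments

variable {n : ℕ} {P : Matrix (Fin n) (Fin n) ℝ} {ρ : ℝ}

theorem integral_bernoulli_centred_pow {x : ℝ} (hx0 : 0 ≤ x) (hx1 : x ≤ 1) (k : ℕ) :
    ∫ b, ((if b = true then (1 : ℝ) else 0) - x) ^ k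
      ∂(bernoulliMeasure true false (Set.projIcc (0 : ℝ) 1 zero_le_one x)) =
    x * (1 - x) ^ k + (1 - x) * (-x) ^ k := by
  rw [integral_bernoulliMeasure, Set.projIcc_of_mem zero_le_one ⟨hx0, hx1⟩]
  simp

/-- The first centred moment vanishes and the higher ones are at most `ρ`. The free parameter `y`
trades the multiplicity of an edge against the number of distinct edges, so no parity or pairing
condition has to be tracked. -/
theorem abs_centred_moment_le {x y : ℝ} (hx0 : 0 ≤ x) (hx1 : x ≤ 1) (hxρ : x ≤ ρ) (hy : 1 ≤ y)
    (k : ℕ) : |x * (1 - x) ^ k + (1 - x) * (-x) ^ k| ≤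
      y ^ k * (if k = 0 then 1 else ρ / y ^ 2) := by
  have hy0 : 0 < y := by linarith
  match k with
  | 0 => simp
  | 1 =>
    rw [show x * (1 - x) ^ 1 + (1 - x) * (-x) ^ 1 = 0 by ring, abs_zero]
    have : 0 ≤ ρ := hx0.trans hxρ
    simp only [one_ne_zero, if_false]
    positivity
  | k + 2 =>
    have h1 : |x * (1 - x) ^ (k + 2) + (1 - x) * (-x) ^ (k + 2)| ≤ ρ := by
      refine (abs_add_le _ _).trans ?_
      rw [abs_mul, abs_mul, abs_pow, abs_pow, abs_neg, abs_of_nonneg hx0,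
        abs_of_nonneg (sub_nonneg.2 hx1)]
      have a1 : (1 - x) ^ (k + 2) ≤ (1 - x) ^ 2 :=
        pow_le_pow_of_le_one (sub_nonneg.2 hx1) (by linarith) (by omega)
      have a2 : x ^ (k + 2) ≤ x ^ 2 := pow_le_pow_of_le_one hx0 hx1 (by omega)
      nlinarith [mul_le_mul_of_nonneg_left a1 hx0,
        mul_le_mul_of_nonneg_left a2 (sub_nonneg.2 hx1)]
    simp only [Nat.add_eq_zero_iff, OfNat.ofNat_ne_zero, and_false, if_false]
    have : y ^ (k + 2) * (ρ / y ^ 2) = y ^ k * ρ := by field_simp; ring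
    rw [this]
    exact h1.trans (le_mul_of_one_le_left (hx0.trans hxρ) (one_le_pow₀ hy))

theorem integral_prod_edgeNoise (M : Multiset (Sym2 (Fin n))) :
    ∫ ω, (M.map (edgeNoise P ω)).prod ∂(graphLaw P) =
      ∏ e : Sym2 (Fin n), ∫ b, ((if b = true then (1 : ℝ) else 0) - P e.inf e.sup) ^ M.count e
        ∂(bernoulliMeasure true false (Set.projIcc (0 : ℝ) 1 zero_le_one (P e.inf e.sup))) := by
  unfold graphLaw
  rw [← integral_fintype_prod_eq_prod]
  refine integral_congr_ae (ae_of_all _ fun ω => ?_)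
  simp only
  rw [Finset.prod_multiset_map_count, Finset.prod_subset (Finset.subset_univ _)]
  · rfl
  · intro e _ he
    simp [Multiset.count_eq_zero.2 (by simpa using he)]

theorem abs_integral_prod_edgeNoise_le (hP0 : ∀ i j, 0 ≤ P i j) (hP1 : ∀ i j, P i j ≤ 1)
    (hPρ : ∀ i j, P i j ≤ ρ) {y : ℝ} (hy : 1 ≤ y) (M : Multiset (Sym2 (Fin n))) :
    |∫ ω, (M.map (edgeNoise P ω)).prod ∂(graphLaw P)| ≤
      y ^ M.card * (ρ / y ^ 2) ^ M.toFinset.card := by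
  rw [integral_prod_edgeNoise, Finset.abs_prod]
  calc _ ≤ ∏ e, y ^ M.count e * (if M.count e = 0 then 1 else ρ / y ^ 2) := by
        refine Finset.prod_le_prod (fun _ _ => abs_nonneg _) fun e _ => ?_
        rw [integral_bernoulli_centred_pow (hP0 _ _) (hP1 _ _)]
        exact abs_centred_moment_le (hP0 _ _) (hP1 _ _) (hPρ _ _) hy _
    _ = _ := by
        rw [Finset.prod_mul_distrib, Finset.prod_pow_eq_pow_sum,
          Multiset.sum_count_eq_card (fun _ _ => Finset.mem_univ _)]
        congr 1
        simp_rw [Multiset.count_eq_zero, ← Multiset.mem_toFinset]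
        simp_rw [ite_not]
        rw [Finset.prod_ite, Finset.prod_const_one, mul_one, Finset.prod_const,
          Finset.filter_mem_eq_inter, Finset.univ_inter]

/-- The noise variables are uncorrelated with variance at most `ρ`. -/
theorem integral_edgeNoise_mul_le (hP0 : ∀ i j, 0 ≤ P i j) (hP1 : ∀ i j, P i j ≤ 1)
    (hPρ : ∀ i j, P i j ≤ ρ) (e f : Sym2 (Fin n)) :
    |∫ ω, edgeNoise P ω e * edgeNoise P ω f ∂(graphLaw P)| ≤ if e = f then ρ else 0 := by
  have hmul : ∀ ω, edgeNoise P ω e * edgeNoise P ω f =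
      (({e, f} : Multiset (Sym2 (Fin n))).map (edgeNoise P ω)).prod := by simp
  simp_rw [hmul]
  split_ifs with h
  · simpa [h] using abs_integral_prod_edgeNoise_le hP0 hP1 hPρ le_rfl {e, f}
  · rw [integral_prod_edgeNoise, Finset.prod_eq_zero (Finset.mem_univ e), abs_zero]
    rw [integral_bernoulli_centred_pow (hP0 _ _) (hP1 _ _)]
    have : Multiset.count e {e, f} = 1 := by
      simp [Multiset.insert_eq_cons, h]
    rw [this]; ring

theorem card_filter_mem_le (M : Multiset (Sym2 (Fin n))) (i : Fin n) :
    (Finset.univ.filter fun k => s(i, k) ∈ M).card ≤ M.card := by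
  refine le_trans ?_ (Multiset.toFinset_card_le M)
  refine Finset.card_le_card_of_injOn (fun k => s(i, k)) (fun k hk => ?_) fun k _ l _ h => ?_
  · simpa using hk
  · exact Sym2.congr_right.1 h

/-- A step along a new edge has at most `n` choices and gains a factor `x`; a step along an old edge
gains nothing but has at most `M.card` choices. -/
theorem sum_pow_card_toFinset_cons_le {x : ℝ} (hx : 0 ≤ x) (M : Multiset (Sym2 (Fin n)))
    (i : Fin n) : ∑ k, x ^ (s(i, k) ::ₘ M).toFinset.card ≤
      x ^ M.toFinset.card * (n * x + M.card) := by
  calc _ ≤ ∑ k, (x ^ M.toFinset.card * x +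
        if s(i, k) ∈ M then x ^ M.toFinset.card else 0) := by
        refine Finset.sum_le_sum fun k _ => ?_
        rw [Multiset.toFinset_cons]
        split_ifs with h
        · rw [Finset.insert_eq_of_mem (by simpa using h)]
          exact le_add_of_nonneg_left (by positivity)
        · rw [Finset.card_insert_of_notMem (by simpa using h), pow_succ, add_zero]
    _ = x ^ M.toFinset.card * (n * x +
        ((Finset.univ.filter fun k => s(i, k) ∈ M).card : ℝ)) := by
        rw [Finset.sum_add_distrib, ← Finset.sum_filter]
        simp
        ring
    _ ≤ _ := by
        have : ((Finset.univ.filter fun k => s(i, k) ∈ M).card : ℝ) ≤ M.card := by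
          exact_mod_cast card_filter_mem_le M i
        gcongr

/-- Walks are expanded one step at a time, with `M` recording the edges already used. Generalizing
over `M` lets induction on the length replace the enumeration of closed walks. -/
theorem abs_integral_prod_mul_pow_apply_le (hP0 : ∀ i j, 0 ≤ P i j) (hP1 : ∀ i j, P i j ≤ 1)
    (hPρ : ∀ i j, P i j ≤ ρ) (hρ : 0 ≤ ρ) {y : ℝ} (hy : 1 ≤ y) (L : ℕ) (i j : Fin n)
    (M : Multiset (Sym2 (Fin n))) :
    |∫ ω, (M.map (edgeNoise P ω)).prod * (noiseMatrix P ω ^ L) i j ∂(graphLaw P)| ≤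
      y ^ (M.card + L) * (ρ / y ^ 2) ^ M.toFinset.card *
        (n * (ρ / y ^ 2) + (M.card + L : ℕ)) ^ L := by
  have hy0 : 0 < y := by linarith
  have hx : 0 ≤ ρ / y ^ 2 := by positivity
  induction L generalizing i M with
  | zero =>
    simp only [pow_zero, Matrix.one_apply, add_zero, mul_one]
    split_ifs
    · simpa using abs_integral_prod_edgeNoise_le hP0 hP1 hPρ hy M
    · simp only [mul_zero, integral_zero, abs_zero]
      positivity
  | succ L ih =>
    have hexp : ∀ ω, (M.map (edgeNoise P ω)).prod * (noiseMatrix P ω ^ (L + 1)) i j =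
        ∑ k, ((s(i, k) ::ₘ M).map (edgeNoise P ω)).prod * (noiseMatrix P ω ^ L) k j := by
      intro ω
      rw [pow_succ', Matrix.mul_apply, Finset.mul_sum]
      refine Finset.sum_congr rfl fun k _ => ?_
      rw [Multiset.map_cons, Multiset.prod_cons]
      simp only [noiseMatrix, Matrix.of_apply]
      ring
    simp_rw [hexp]
    rw [integral_finsetSum _ fun k _ => integrable_graphLaw P _]
    refine (Finset.abs_sum_le_sum_abs _ _).trans ((Finset.sum_le_sum fun k _ =>
      ih k (s(i, k) ::ₘ M)).trans ?_)
    have hcard : ∀ k, (s(i, k) ::ₘ M).card + L = M.card + (L + 1) := by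
      intro k; rw [Multiset.card_cons]; ring
    simp_rw [hcard, ← Finset.sum_mul, ← Finset.mul_sum]
    have h1 := sum_pow_card_toFinset_cons_le hx M i
    have h2 : (M.card : ℝ) ≤ (M.card + (L + 1) : ℕ) := by exact_mod_cast Nat.le_add_right _ _
    calc _ ≤ y ^ (M.card + (L + 1)) * ((ρ / y ^ 2) ^ M.toFinset.card *
          (n * (ρ / y ^ 2) + (M.card + (L + 1) : ℕ))) *
          (n * (ρ / y ^ 2) + (M.card + (L + 1) : ℕ)) ^ L := by
          refine mul_le_mul_of_nonneg_right (mul_le_mul_of_nonneg_left (h1.trans ?_)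
            (by positivity)) (by positivity)
          gcongr
      _ = _ := by ring

/-- High moments of the noise matrix. -/
theorem integral_trace_noiseMatrix_pow_le (hP0 : ∀ i j, 0 ≤ P i j) (hP1 : ∀ i j, P i j ≤ 1)
    (hPρ : ∀ i j, P i j ≤ ρ) {l : ℕ} (hl : l ≠ 0) (hρ : (2 * l : ℝ) ≤ n * ρ) :
    ∫ ω, (noiseMatrix P ω ^ (2 * l)).trace ∂(graphLaw P) ≤ n * (8 * l * (n * ρ)) ^ l := by
  have hl0 : (0 : ℝ) < l := by exact_mod_cast Nat.pos_of_ne_zero hl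
  have hnρ : 0 < n * ρ := by linarith
  have hn : (0 : ℝ) < n := by
    rcases Nat.eq_zero_or_pos n with h | h
    · simp [h] at hnρ
    · exact_mod_cast h
  have hρ0 : 0 < ρ := pos_of_mul_pos_right hnρ hn.le
  -- With `y² = Y`, new edges have total weight `n * (ρ / Y) = 2l`, matching the bound `2l` on old
  -- ones. The hypothesis on `ρ` is what makes `y ≥ 1`.
  set Y : ℝ := n * ρ / (2 * l) with hY
  have hY1 : 1 ≤ Y := by rw [hY, le_div_iff₀ (by positivity)]; linarith
  have hs : Real.sqrt Y ^ 2 = Y := Real.sq_sqrt (by linarith)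
  have hy : 1 ≤ Real.sqrt Y := Real.one_le_sqrt.2 hY1
  simp_rw [Matrix.trace, Matrix.diag]
  rw [integral_finsetSum _ fun k _ => integrable_graphLaw P _]
  calc _ ≤ ∑ _i : Fin n, (8 * l * (n * ρ)) ^ l := by
        refine Finset.sum_le_sum fun i _ => (le_abs_self _).trans ?_
        have := abs_integral_prod_mul_pow_apply_le hP0 hP1 hPρ hρ0.le hy (2 * l) i i 0
        simp only [Multiset.map_zero, Multiset.prod_zero, one_mul, Multiset.card_zero, zero_add,
          Multiset.toFinset_zero, Finset.card_empty, pow_zero, mul_one, hs] at this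
        rw [pow_mul (Real.sqrt Y), hs, pow_mul (_ + _), ← mul_pow] at this
        refine this.trans (le_of_eq ?_)
        congr 1
        rw [hY]
        push_cast
        field_simp
        ring
    _ = _ := by simp

theorem integral_sq_sum_noiseMatrix_le (hP0 : ∀ i j, 0 ≤ P i j) (hP1 : ∀ i j, P i j ≤ 1)
    (hPρ : ∀ i j, P i j ≤ ρ) (hρ : 0 ≤ ρ) (a : Fin n → Fin n → ℝ) :
    ∫ ω, (∑ i, ∑ j, a i j * noiseMatrix P ω i j) ^ 2 ∂(graphLaw P) ≤
      2 * ρ * ∑ i, ∑ j, a i j ^ 2 := by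
  have hexp : ∀ ω, (∑ i, ∑ j, a i j * noiseMatrix P ω i j) ^ 2 =
      ∑ r : Fin n × Fin n, ∑ t : Fin n × Fin n,
        a r.1 r.2 * a t.1 t.2 * (edgeNoise P ω s(r.1, r.2) * edgeNoise P ω s(t.1, t.2)) := by
    intro ω
    rw [← Fintype.sum_prod_type' (f := fun i j => a i j * noiseMatrix P ω i j), sq,
      Finset.sum_mul_sum]
    refine Finset.sum_congr rfl fun r _ => Finset.sum_congr rfl fun t _ => ?_
    simp only [noiseMatrix, Matrix.of_apply]
    ring
  simp_rw [hexp]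
  rw [integral_finsetSum _ fun k _ => integrable_graphLaw P _]
  simp_rw [integral_finsetSum _ fun k _ => integrable_graphLaw P _, integral_const_mul]
  -- Only ordered pairs naming the same edge correlate: `t = r` or its swap. As `a` need not be
  -- symmetric, the swapped products are split by AM–GM.
  calc _ ≤ ∑ r : Fin n × Fin n, ∑ t : Fin n × Fin n,
        ((if t = r then ρ * a r.1 r.2 ^ 2 else 0) +
          if t = r.swap then ρ * ((a r.1 r.2 ^ 2 + a t.1 t.2 ^ 2) / 2) else 0) := by
        refine Finset.sum_le_sum fun r _ => Finset.sum_le_sum fun t _ => ?_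
        refine (le_abs_self _).trans ?_
        rw [abs_mul]
        refine (mul_le_mul_of_nonneg_left (integral_edgeNoise_mul_le hP0 hP1 hPρ _ _)
          (abs_nonneg _)).trans ?_
        have hpos : 0 ≤ ρ * ((a r.1 r.2 ^ 2 + a t.1 t.2 ^ 2) / 2) := by positivity
        have hpos' : 0 ≤ ρ * a r.1 r.2 ^ 2 := by positivity
        by_cases h1 : t = r
        · subst h1
          rw [if_pos rfl, if_pos rfl, abs_mul, abs_mul_abs_self]
          split_ifs <;> nlinarith
        · rw [if_neg h1]
          by_cases h2 : t = r.swap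
          · rw [if_pos h2, if_pos (by rw [h2]; exact Sym2.eq_swap), abs_mul]
            nlinarith [sq_nonneg (|a r.1 r.2| - |a t.1 t.2|), sq_abs (a r.1 r.2),
              sq_abs (a t.1 t.2)]
          · rw [if_neg, if_neg h2]
            · simp
            · intro h
              rcases Sym2.eq_iff.1 h with h | h
              · exact h1 (Prod.ext h.1.symm h.2.symm)
              · exact h2 (Prod.ext h.2.symm h.1.symm)
    _ = _ := by
        simp only [Finset.sum_add_distrib, Finset.sum_ite_eq', Finset.mem_univ, if_true]
        rw [← Finset.mul_sum, ← Finset.mul_sum, ← Finset.sum_div, Finset.sum_add_distrib]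
        have : ∑ r : Fin n × Fin n, a r.swap.1 r.swap.2 ^ 2 = ∑ r : Fin n × Fin n, a r.1 r.2 ^ 2 :=
          Equiv.sum_comp (Equiv.prodComm (Fin n) (Fin n)) fun r => a r.1 r.2 ^ 2
        rw [this, ← Fintype.sum_prod_type' (f := fun i j => a i j ^ 2)]
        ring

theorem measureReal_ge_le_div (f : Graph01 n → ℝ) (hf : ∀ ω, 0 ≤ f ω) {b K : ℝ} (hb : 0 < b)
    (hK : ∫ ω, f ω ∂(graphLaw P) ≤ K) : (graphLaw P).real {ω | b ≤ f ω} ≤ K / b := by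
  rw [le_div_iff₀' hb]
  exact (mul_meas_ge_le_integral_of_nonneg (ae_of_all _ hf) (integrable_graphLaw P f) b).trans hK

end Moments

/-! ### Block structure and deterministic eigenvalue bounds. -/

section BlockModel

open Matrix

theorem BalancedBlocks.sum_comp {m : ℕ} {z : Fin (3 * m) → Fin 3} (hz : BalancedBlocks z)
    (g : Fin 3 → ℝ) : ∑ i, g (z i) = m * ∑ k, g k := by
  rw [← Finset.sum_fiberwise' Finset.univ z g, Finset.mul_sum]
  refine Finset.sum_congr rfl fun k _ => ?_
  rw [Finset.sum_const, hz k, nsmul_eq_mul]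

/-- The quadratic form of a block matrix depends only on the block sums of the vector. -/
theorem dotProduct_edgeProb_mulVec {n : ℕ} (B : Matrix (Fin 3) (Fin 3) ℝ) (z : Fin n → Fin 3)
    (x : Fin n → ℝ) :
    x ⬝ᵥ edgeProb B z *ᵥ x =
      ∑ k, ∑ l, (∑ i with z i = k, x i) * B k l * ∑ i with z i = l, x i := by
  have h1 : ∀ i, (edgeProb B z *ᵥ x) i = ∑ l, B (z i) l * ∑ j with z j = l, x j := by
    intro i
    simp only [mulVec, dotProduct, edgeProb, of_apply]
    rw [← Finset.sum_fiberwise Finset.univ z]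
    refine Finset.sum_congr rfl fun l _ => ?_
    rw [Finset.mul_sum]
    refine Finset.sum_congr rfl fun j hj => ?_
    rw [(Finset.mem_filter.1 hj).2]
  simp only [dotProduct, h1]
  rw [← Finset.sum_fiberwise Finset.univ z]
  refine Finset.sum_congr rfl fun k _ => ?_
  calc _ = ∑ i with z i = k, x i * ∑ l, B k l * ∑ j with z j = l, x j :=
        Finset.sum_congr rfl fun i hi => by rw [(Finset.mem_filter.1 hi).2]
    _ = _ := by
        rw [← Finset.sum_mul, Finset.mul_sum]
        exact Finset.sum_congr rfl fun l _ => by ring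

/-- The indicator vector of block `k`. -/
noncomputable def blockVec {n : ℕ} (z : Fin n → Fin 3) (k : Fin 3) : Fin n → ℝ :=
  fun i => if z i = k then 1 else 0

theorem sum_smul_blockVec {n : ℕ} (z : Fin n → Fin 3) (a : Fin 3 → ℝ) :
    ∑ k, a k • blockVec z k = fun i => a (z i) := by
  ext i
  simp [Finset.sum_apply, blockVec]

theorem blockVec_dotProduct {n : ℕ} (z : Fin n → Fin 3) (k : Fin 3) (x : Fin n → ℝ) :
    blockVec z k ⬝ᵥ x = ∑ i with z i = k, x i := by
  simp [dotProduct, blockVec, Finset.sum_filter]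

theorem edgeProb_isSymm {n : ℕ} {B : Matrix (Fin 3) (Fin 3) ℝ} (hB : B.IsSymm)
    (z : Fin n → Fin 3) : (edgeProb B z).IsSymm := by
  ext i j
  exact hB.apply _ _

theorem blockNull_isSymm (p q : ℝ) : (blockNull p q).IsSymm := by
  ext i j
  fin_cases i <;> fin_cases j <;> rfl

theorem blockAlt_isSymm (p q ε : ℝ) : (blockAlt p q ε).IsSymm := by
  ext i j
  fin_cases i <;> fin_cases j <;> rfl

theorem blockNull_mem_Icc {p q : ℝ} (hq : 0 < q) (hqp : q < p) (k l : Fin 3) :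
    blockNull p q k l ∈ Set.Icc 0 p := by
  have hp := hq.trans hqp
  fin_cases k <;> fin_cases l <;> simp [blockNull] <;> (try constructor) <;> linarith

theorem blockAlt_mem_Icc {p q ε : ℝ} (hq : 0 < q) (hε : 0 < ε) (hεpq : ε < p - q)
    (k l : Fin 3) : blockAlt p q ε k l ∈ Set.Icc 0 p := by
  fin_cases k <;> fin_cases l <;> simp [blockAlt] <;> (try constructor) <;> linarith

theorem smallestSignalEigenvalue_of_pos {m : ℕ} (hm : 0 < m) (ω : Graph01 (3 * m)) :
    ∃ h : 2 < Fintype.card (Fin (3 * m)),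
      smallestSignalEigenvalue ω = (adjacency_isHermitian ω).eigenvalues₀ ⟨2, h⟩ := by
  have h : 2 < Fintype.card (Fin (3 * m)) := by rw [Fintype.card_fin]; omega
  exact ⟨h, dif_pos h⟩

/-- If the block averages of the noise are small, the third eigenvalue is not much below its null
value. -/
theorem le_smallestSignalEigenvalue_of_blockNoise {m : ℕ} (hm : 0 < m) {z : Fin (3 * m) → Fin 3}
    (hz : BalancedBlocks z) {p q ε : ℝ} (hq : 0 < q) (ω : Graph01 (3 * m))
    (hD : ∀ k l, |∑ i, ∑ j, blockVec z k i * blockVec z l j *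
      noiseMatrix (edgeProb (blockNull p q) z) ω i j| ≤ (m : ℝ) ^ 2 * ε / 6) :
    m * (p - q) - m * ε / 2 ≤ smallestSignalEigenvalue ω := by
  have hm0 : (0 : ℝ) < m := by exact_mod_cast hm
  obtain ⟨h, heq⟩ := smallestSignalEigenvalue_of_pos hm ω
  set E := noiseMatrix (edgeProb (blockNull p q) z) ω
  set D : Fin 3 → Fin 3 → ℝ := fun k l => ∑ i, ∑ j, blockVec z k i * blockVec z l j * E i j with hDef
  have hnorm (a : Fin 3 → ℝ) :
      (∑ k, a k • blockVec z k) ⬝ᵥ (∑ k, a k • blockVec z k) = m * ∑ k, a k ^ 2 := by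
    rw [sum_smul_blockVec, ← hz.sum_comp]
    simp [dotProduct, sq]
  have hnoise (a : Fin 3 → ℝ) : (∑ k, a k • blockVec z k) ⬝ᵥ E *ᵥ (∑ k, a k • blockVec z k) =
      ∑ k, ∑ l, a k * a l * D k l := by
    have hb (k l) : D k l = blockVec z k ⬝ᵥ E *ᵥ blockVec z l := by
      simp only [hDef, dotProduct, mulVec, Finset.mul_sum]
      exact Finset.sum_congr rfl fun i _ => Finset.sum_congr rfl fun j _ => by ring
    simp only [hb, sum_dotProduct, mulVec_sum, dotProduct_sum, mulVec_smul, smul_dotProduct,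
      dotProduct_smul, smul_eq_mul]
    rw [Finset.sum_comm]
    refine Finset.sum_congr rfl fun k _ => ?_
    rw [Finset.mul_sum]
    exact Finset.sum_congr rfl fun l _ => by ring
  rw [heq]
  refine (adjacency_isHermitian ω).le_eigenvalues₀_two h (blockVec z) _ (fun a ha => ?_)
    fun a => ?_
  · rw [hnorm]
    obtain ⟨k, hk⟩ := Function.ne_iff.1 ha
    have hk : a k ≠ 0 := hk
    exact mul_pos hm0 (Finset.sum_pos' (fun _ _ => sq_nonneg _)
      ⟨k, Finset.mem_univ _, by positivity⟩)
  · rw [adjacency_eq_add_noiseMatrix (edgeProb_isSymm (blockNull_isSymm p q) z) ω, add_mulVec,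
      dotProduct_add, hnoise, hnorm, dotProduct_edgeProb_mulVec]
    have hs (k : Fin 3) : ∑ i with z i = k, (∑ k, a k • blockVec z k) i = m * a k := by
      rw [sum_smul_blockVec, Finset.sum_congr rfl (g := fun _ => a k)
        fun i hi => congrArg a (Finset.mem_filter.1 hi).2, Finset.sum_const, hz k, nsmul_eq_mul]
    simp_rw [hs]
    have hP : ∑ k, ∑ l, m * a k * blockNull p q k l * (m * a l) =
        (m : ℝ) ^ 2 * ((p - q) * ∑ k, a k ^ 2 + q * (∑ k, a k) ^ 2) := by
      simp [Fin.sum_univ_three, blockNull]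
      ring
    have hDle : -(∑ k, ∑ l, a k * a l * D k l) ≤ ((m : ℝ) ^ 2 * ε / 6) * (∑ k, |a k|) ^ 2 := by
      rw [sq (∑ k, |a k|), Finset.sum_mul_sum, Finset.mul_sum]
      refine (neg_le_abs _).trans ((Finset.abs_sum_le_sum_abs _ _).trans
        (Finset.sum_le_sum fun k _ => ?_))
      rw [Finset.mul_sum]
      refine (Finset.abs_sum_le_sum_abs _ _).trans (Finset.sum_le_sum fun l _ => ?_)
      rw [abs_mul, abs_mul, mul_comm]
      exact mul_le_mul_of_nonneg_right (hD k l) (by positivity)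
    -- The factor 3 turns the tolerance `m²ε/6` per block into the loss `mε/2`.
    have hcs : (∑ k, |a k|) ^ 2 ≤ 3 * ∑ k, a k ^ 2 := by
      have := sq_sum_le_card_mul_sum_sq (s := (Finset.univ : Finset (Fin 3))) (f := fun k => |a k|)
      simpa using this
    have hε : 0 ≤ (m : ℝ) ^ 2 * ε / 6 := (abs_nonneg _).trans (hD 0 0)
    rw [hP]
    have h1 := mul_le_mul_of_nonneg_left hcs hε
    have h2 : 0 ≤ (m : ℝ) ^ 2 * (q * (∑ k, a k) ^ 2) := by positivity
    linarith

/-- The contrast between the blocks `0` and `1`. -/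
noncomputable def contrastVec {n : ℕ} (z : Fin n → Fin 3) : Fin n → ℝ :=
  blockVec z 0 - blockVec z 1

theorem sum_sq_contrastVec {m : ℕ} {z : Fin (3 * m) → Fin 3} (hz : BalancedBlocks z) :
    ∑ i, contrastVec z i ^ 2 = 2 * m := by
  have := hz.sum_comp fun k => ((if k = 0 then 1 else 0) - (if k = 1 then 1 else 0)) ^ 2
  simp only [contrastVec, blockVec, Pi.sub_apply]
  rw [this]
  simp [Fin.sum_univ_three]
  ring

theorem sum_sq_blockVec {m : ℕ} {z : Fin (3 * m) → Fin 3} (hz : BalancedBlocks z) (k : Fin 3) :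
    ∑ i, blockVec z k i ^ 2 = m := by
  have := hz.sum_comp fun l => (if l = k then 1 else 0) ^ 2
  simp only [blockVec]
  rw [this]
  simp

/-- Second order eigenvalue perturbation: an upper bound on the third eigenvalue under the
alternative. -/
theorem smallestSignalEigenvalue_le_of_noise {m : ℕ} (hm : 0 < m) {z : Fin (3 * m) → Fin 3}
    (hz : BalancedBlocks z) {p q ε c : ℝ} (hq : 0 < q) (hqp : q < p) (hε : 0 < ε)
    (hεpq : ε < p - q) (hc : 0 < c) (hsignal : c * (p + 2 * q) ≤ p - q) (ω : Graph01 (3 * m))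
    {E : Matrix (Fin (3 * m)) (Fin (3 * m)) ℝ}
    (hE : E = noiseMatrix (edgeProb (blockAlt p q ε) z) ω)
    (hnorm : ∀ w, w ⬝ᵥ E *ᵥ w ≤ c * m * p / 8 * (w ⬝ᵥ w))
    (hdiag : contrastVec z ⬝ᵥ E *ᵥ contrastVec z ≤ (m : ℝ) ^ 2 * ε / 4)
    (hcol : (E *ᵥ contrastVec z) ⬝ᵥ (E *ᵥ contrastVec z) ≤ c * (m : ℝ) ^ 3 * ε * p / 32) :
    smallestSignalEigenvalue ω ≤ m * (p - q) - 3 / 4 * (m * ε) := by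
  have hm0 : (0 : ℝ) < m := by exact_mod_cast hm
  obtain ⟨h, heq⟩ := smallestSignalEigenvalue_of_pos hm ω
  rw [heq]
  -- These constraints kill the sum of blocks 0 and 1 and the block 2 sum, leaving only the contrast
  -- visible to the edge probabilities.
  refine (adjacency_isHermitian ω).eigenvalues₀_two_le h
    ![blockVec z 0 + blockVec z 1, blockVec z 2] _ fun x hx => ?_
  have h0 := hx 0
  have h1 := hx 1
  simp only [cons_val_zero, cons_val_one, add_dotProduct, blockVec_dotProduct] at h0 h1
  set u := contrastVec z with hu
  have huu : u ⬝ᵥ u = 2 * m := by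
    rw [← sum_sq_contrastVec hz]
    simp [dotProduct, sq, hu]
  set a : ℝ := (u ⬝ᵥ x) / (2 * m) with ha
  have hux : u ⬝ᵥ x = 2 * m * a := by rw [ha]; field_simp
  have hux' : (∑ i with z i = 0, x i) - ∑ i with z i = 1, x i = 2 * m * a := by
    rw [← hux, hu, contrastVec, sub_dotProduct, blockVec_dotProduct, blockVec_dotProduct]
  have hs0 : ∑ i with z i = 0, x i = m * a := by linarith
  have hs1 : ∑ i with z i = 1, x i = -(m * a) := by linarith
  have hP : x ⬝ᵥ edgeProb (blockAlt p q ε) z *ᵥ x = 2 * (m : ℝ) ^ 2 * a ^ 2 * (p - q - ε) := by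
    rw [dotProduct_edgeProb_mulVec]
    simp [Fin.sum_univ_three, blockAlt, hs0, hs1, h1]
    ring
  set w := x - a • u with hw
  have hxw : x = a • u + w := by rw [hw]; abel
  have huw : u ⬝ᵥ w = 0 := by
    rw [hw, dotProduct_sub, dotProduct_smul, huu, hux, smul_eq_mul]; ring
  have hxx : x ⬝ᵥ x = 2 * m * a ^ 2 + w ⬝ᵥ w := by
    rw [hxw]
    simp only [add_dotProduct, dotProduct_add, smul_dotProduct, dotProduct_smul, huu, huw,
      dotProduct_comm w u, smul_eq_mul]
    ring
  have hEsymm : u ⬝ᵥ E *ᵥ w = w ⬝ᵥ E *ᵥ u := by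
    have : Eᵀ = E := by
      rw [hE]
      simpa using (noiseMatrix_isHermitian (edgeProb (blockAlt p q ε) z) ω).eq
    rw [dotProduct_mulVec, ← mulVec_transpose, this, dotProduct_comm]
  have hxE : x ⬝ᵥ E *ᵥ x = a ^ 2 * (u ⬝ᵥ E *ᵥ u) + 2 * a * (w ⬝ᵥ E *ᵥ u) + w ⬝ᵥ E *ᵥ w := by
    conv_lhs => rw [hxw]
    simp only [add_dotProduct, dotProduct_add, smul_dotProduct, dotProduct_smul, mulVec_add,
      mulVec_smul, hEsymm, smul_eq_mul]
    ring
  rw [adjacency_eq_add_noiseMatrix (edgeProb_isSymm (blockAlt_isSymm p q ε) z) ω, ← hE,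
    add_mulVec, dotProduct_add, hP, hxE, hxx]
  have hww : 0 ≤ w ⬝ᵥ w := Finset.sum_nonneg fun i _ => mul_self_nonneg _
  set W := w ⬝ᵥ w
  set s := w ⬝ᵥ E *ᵥ u
  -- `G` and `H` are the noise budgets for the coefficients of `a²` and `W`; the bound in `hcol` is
  -- exactly `G * H`, as the AM–GM step `hcross` needs.
  set G : ℝ := (m : ℝ) ^ 2 * ε / 4 with hG
  set H : ℝ := c * m * p / 8 with hH
  have hG0 : 0 < G := by positivity
  have hH0 : 0 < H := by have : 0 < p := hq.trans hqp; positivity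
  have hcs : s ^ 2 ≤ W * (G * H) := by
    have : s ^ 2 ≤ W * ((E *ᵥ u) ⬝ᵥ (E *ᵥ u)) := by
      have := Finset.sum_mul_sq_le_sq_mul_sq Finset.univ w (E *ᵥ u)
      simpa [s, W, dotProduct, sq] using this
    refine this.trans (mul_le_mul_of_nonneg_left (hcol.trans (le_of_eq ?_)) hww)
    rw [hG, hH]; ring
  have hcross : 2 * a * s ≤ G * a ^ 2 + H * W := by
    refine abs_le_of_sq_le_sq' ?_ (by positivity) |>.2
    nlinarith [mul_le_mul_of_nonneg_left hcs (sq_nonneg a), sq_nonneg (G * a ^ 2 - H * W)]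
  -- Since `ε < p - q`, a quarter of the signal remains, which is at least `c m p / 4 = 2H`. This
  -- pays for both `W` terms.
  have ht : 2 * H ≤ m * (p - q) - 3 / 4 * (m * ε) := by
    have e1 : m * ε ≤ m * (p - q) := mul_le_mul_of_nonneg_left hεpq.le hm0.le
    have e2 : m * (c * (p + 2 * q)) ≤ m * (p - q) := mul_le_mul_of_nonneg_left hsignal hm0.le
    have e3 : 0 < m * (c * q) := by positivity
    rw [hH]; linarith
  have h3 := mul_le_mul_of_nonneg_left hdiag (sq_nonneg a)
  have h4 := hnorm w
  have h5 := mul_le_mul_of_nonneg_right ht hww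
  have h6 : (m * (p - q) - 3 / 4 * (m * ε)) * (2 * m * a ^ 2) =
    2 * (m : ℝ) ^ 2 * a ^ 2 * (p - q - ε) + 2 * G * a ^ 2 := by rw [hG]; ring
  linarith

/-! ### Error probabilities at finite size. -/

theorem measureReal_reject_null_le {m : ℕ} (hm : 0 < m) {z : Fin (3 * m) → Fin 3}
    (hz : BalancedBlocks z) {p q ε : ℝ} (hq : 0 < q) (hqp : q < p) (hp : p ≤ 1) (hε : 0 < ε) :
    (graphLaw (edgeProb (blockNull p q) z)).real
      (rejectionRegion (3 * m) (m * (p - q) - m * ε / 2)) ≤ 648 / (m * ε) ^ 2 := by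
  have hm0 : (0 : ℝ) < m := by exact_mod_cast hm
  have hp0 : 0 < p := hq.trans hqp
  set P := edgeProb (blockNull p q) z with hP
  have hP0 (i j) : P i j ∈ Set.Icc 0 p := blockNull_mem_Icc hq hqp _ _
  set D : Fin 3 × Fin 3 → Graph01 (3 * m) → ℝ := fun r ω =>
    ∑ i, ∑ j, blockVec z r.1 i * blockVec z r.2 j * noiseMatrix P ω i j with hD
  have hsub : rejectionRegion (3 * m) (m * (p - q) - m * ε / 2) ⊆
      ⋃ r, {ω | ((m : ℝ) ^ 2 * ε / 6) ^ 2 ≤ D r ω ^ 2} := by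
    intro ω hω
    by_contra hcon
    simp only [Set.mem_iUnion, Set.mem_ofPred_eq, not_exists, not_le] at hcon
    refine absurd (le_smallestSignalEigenvalue_of_blockNoise hm hz hq ω (ε := ε) fun k l => ?_)
      (not_le.2 hω)
    exact abs_le_of_sq_le_sq (hcon (k, l)).le (by positivity)
  have hvar (r) : (graphLaw P).real {ω | ((m : ℝ) ^ 2 * ε / 6) ^ 2 ≤ D r ω ^ 2} ≤
      72 / (m * ε) ^ 2 := by
    have h1 := integral_sq_sum_noiseMatrix_le (fun i j => (hP0 i j).1)
      (fun i j => (hP0 i j).2.trans hp) (fun i j => (hP0 i j).2) hp0.le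
      fun i j => blockVec z r.1 i * blockVec z r.2 j
    have h2 : ∑ i, ∑ j, (blockVec z r.1 i * blockVec z r.2 j) ^ 2 = (m : ℝ) ^ 2 := by
      simp_rw [mul_pow, ← Finset.mul_sum, ← Finset.sum_mul, sum_sq_blockVec hz]
      ring
    rw [h2] at h1
    refine (measureReal_ge_le_div (fun ω => D r ω ^ 2) (fun ω => sq_nonneg _) (by positivity)
      (h1.trans (mul_le_mul_of_nonneg_right (mul_le_mul_of_nonneg_left hp zero_le_two)
        (sq_nonneg _)))).trans (le_of_eq ?_)
    field_simp
    norm_num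
  calc _ ≤ (graphLaw P).real (⋃ r, {ω | ((m : ℝ) ^ 2 * ε / 6) ^ 2 ≤ D r ω ^ 2}) :=
        measureReal_mono hsub
    _ ≤ ∑ r, (graphLaw P).real {ω | ((m : ℝ) ^ 2 * ε / 6) ^ 2 ≤ D r ω ^ 2} :=
        measureReal_iUnion_fintype_le _
    _ ≤ ∑ _r : Fin 3 × Fin 3, 72 / (m * ε) ^ 2 := Finset.sum_le_sum fun r _ => hvar r
    _ = 648 / (m * ε) ^ 2 := by
        rw [Finset.sum_const, Finset.card_univ, Fintype.card_prod, Fintype.card_fin, nsmul_eq_mul]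
        push_cast
        ring

/-- The three summands are the Markov bounds for the failure of the diagonal, column and norm
estimates, in that order. -/
theorem measureReal_accept_alt_le {m : ℕ} (hm : 0 < m) {z : Fin (3 * m) → Fin 3}
    (hz : BalancedBlocks z) {p q ε c : ℝ} (hq : 0 < q) (hqp : q < p) (hp : p ≤ 1) (hε : 0 < ε)
    (hεpq : ε < p - q) (hc : 0 < c) (hsignal : c * (p + 2 * q) ≤ p - q) {l : ℕ} (hl : l ≠ 0)
    (hlp : (2 * l : ℝ) ≤ (3 * m : ℕ) * p) :
    (graphLaw (edgeProb (blockAlt p q ε) z)).real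
      (rejectionRegion (3 * m) (m * (p - q) - m * ε / 2))ᶜ ≤
      128 / (m * ε) ^ 2 + 384 / (c * (m * ε)) +
        (3 * m : ℕ) * (4608 * l / (c ^ 2 * ((3 * m : ℕ) * p))) ^ l := by
  have hm0 : (0 : ℝ) < m := by exact_mod_cast hm
  have hp0 : 0 < p := hq.trans hqp
  set P := edgeProb (blockAlt p q ε) z with hP
  have hP0 (i j) : P i j ∈ Set.Icc 0 p := blockAlt_mem_Icc hq hε hεpq _ _
  set u := contrastVec z with hu
  have husq : ∑ i, u i ^ 2 = 2 * m := sum_sq_contrastVec hz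
  set S1 : Set (Graph01 (3 * m)) :=
    {ω | ((m : ℝ) ^ 2 * ε / 4) ^ 2 ≤ (∑ i, ∑ j, u i * u j * noiseMatrix P ω i j) ^ 2}
  set S2 : Set (Graph01 (3 * m)) :=
    {ω | c * (m : ℝ) ^ 3 * ε * p / 32 ≤ ∑ i, (∑ j, noiseMatrix P ω i j * u j) ^ 2}
  set S3 : Set (Graph01 (3 * m)) :=
    {ω | (c * m * p / 8) ^ (2 * l) ≤ (noiseMatrix P ω ^ (2 * l)).trace}
  have hsub : (rejectionRegion (3 * m) (m * (p - q) - m * ε / 2))ᶜ ⊆ S1 ∪ S2 ∪ S3 := by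
    intro ω hω
    by_contra hcon
    simp only [S1, S2, S3, Set.mem_union, Set.mem_ofPred_eq, not_or, not_le] at hcon
    obtain ⟨⟨h1, h2⟩, h3⟩ := hcon
    refine hω ((smallestSignalEigenvalue_le_of_noise hm hz hq hqp hε hεpq hc hsignal ω rfl
      (fun w => ?_) ?_ ?_).trans_lt ?_)
    · exact (noiseMatrix_isHermitian P ω).dotProduct_mulVec_le_of_trace_pow_le hl (by positivity)
        h3.le w
    · refine le_trans (le_of_eq ?_) ((le_abs_self _).trans
        (abs_le_of_sq_le_sq h1.le (by positivity)))
      simp only [dotProduct, mulVec, Finset.mul_sum]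
      exact Finset.sum_congr rfl fun i _ => Finset.sum_congr rfl fun j _ => by ring
    · refine le_trans (le_of_eq ?_) h2.le
      simp only [dotProduct, mulVec, sq, hu, hP]
    · have : 0 < m * ε := by positivity
      linarith
  have hS1 : (graphLaw P).real S1 ≤ 128 / (m * ε) ^ 2 := by
    have h1 := integral_sq_sum_noiseMatrix_le (fun i j => (hP0 i j).1)
      (fun i j => (hP0 i j).2.trans hp) (fun i j => (hP0 i j).2) hp0.le fun i j => u i * u j
    have h2 : ∑ i, ∑ j, (u i * u j) ^ 2 = (2 * m : ℝ) ^ 2 := by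
      simp_rw [mul_pow, ← Finset.mul_sum, ← Finset.sum_mul, husq]
      ring
    rw [h2] at h1
    refine (measureReal_ge_le_div _ (fun ω => sq_nonneg _) (by positivity)
      (h1.trans (mul_le_mul_of_nonneg_right (mul_le_mul_of_nonneg_left hp zero_le_two)
        (sq_nonneg _)))).trans (le_of_eq ?_)
    field_simp
    norm_num
  have hS2 : (graphLaw P).real S2 ≤ 384 / (c * (m * ε)) := by
    have h1 (i) : ∫ ω, (∑ j, noiseMatrix P ω i j * u j) ^ 2 ∂(graphLaw P) ≤ 2 * p * (2 * m) := by
      have := integral_sq_sum_noiseMatrix_le (fun i j => (hP0 i j).1)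
        (fun i j => (hP0 i j).2.trans hp) (fun i j => (hP0 i j).2) hp0.le
        fun i' j => if i' = i then u j else 0
      have e1 (ω) : ∑ i', ∑ j, (if i' = i then u j else 0) * noiseMatrix P ω i' j =
          ∑ j, noiseMatrix P ω i j * u j := by
        rw [Finset.sum_eq_single i (fun i' _ hi => by simp [hi]) (by simp)]
        simp [mul_comm]
      have e2 : ∑ i', ∑ j, (if i' = i then u j else 0) ^ 2 = 2 * (m : ℝ) := by
        rw [Finset.sum_eq_single i (fun i' _ hi => by simp [hi]) (by simp), ← husq]
        simp
      simpa only [e1, e2] using this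
    have h2 : ∫ ω, ∑ i, (∑ j, noiseMatrix P ω i j * u j) ^ 2 ∂(graphLaw P) ≤
        3 * m * (2 * p * (2 * m)) := by
      rw [integral_finsetSum _ fun k _ => integrable_graphLaw P _]
      refine (Finset.sum_le_sum fun i _ => h1 i).trans (le_of_eq ?_)
      simp
    refine (measureReal_ge_le_div _ (fun ω => Finset.sum_nonneg fun i _ => sq_nonneg _)
      (by positivity) h2).trans (le_of_eq ?_)
    field_simp
    norm_num
  have hS3 : (graphLaw P).real S3 ≤
      (3 * m : ℕ) * (4608 * l / (c ^ 2 * ((3 * m : ℕ) * p))) ^ l := by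
    have h1 := integral_trace_noiseMatrix_pow_le (fun i j => (hP0 i j).1)
      (fun i j => (hP0 i j).2.trans hp) (fun i j => (hP0 i j).2) hl hlp
    refine (measureReal_ge_le_div _ (fun ω => ?_) (by positivity) h1).trans (le_of_eq ?_)
    · rw [(noiseMatrix_isHermitian P ω).trace_pow_eq_sum_eigenvalues]
      exact Finset.sum_nonneg fun i _ => (even_two_mul l).pow_nonneg _
    · rw [pow_mul, mul_div_assoc, ← div_pow]
      congr 2
      push_cast
      field_simp
      norm_num
  calc _ ≤ (graphLaw P).real (S1 ∪ S2 ∪ S3) := measureReal_mono hsub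
    _ ≤ (graphLaw P).real S1 + (graphLaw P).real S2 + (graphLaw P).real S3 :=
        (measureReal_union_le _ _).trans (add_le_add_left (measureReal_union_le _ _) _)
    _ ≤ _ := by gcongr

end BlockModel

/-! ### Asymptotics and conclusion. -/

theorem mul_pow_ceil_log_le_inv {x : ℝ} (hx : 0 < x) {r : ℝ} (hr0 : 0 ≤ r)
    (hr : r ≤ Real.exp (-2)) : x * r ^ ⌈Real.log x⌉₊ ≤ x⁻¹ := by
  have h1 : r ^ ⌈Real.log x⌉₊ ≤ Real.exp (-2 * Real.log x) := by
    refine (pow_le_pow_left₀ hr0 hr _).trans ?_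
    rw [← Real.exp_nat_mul]
    refine Real.exp_le_exp.2 ?_
    linarith [Nat.le_ceil (Real.log x)]
  have h2 : Real.exp (-2 * Real.log x) = x⁻¹ * x⁻¹ := by
    rw [show -2 * Real.log x = -Real.log x + -Real.log x by ring, Real.exp_add, Real.exp_neg,
      Real.exp_log hx]
  rw [h2] at h1
  calc x * r ^ ⌈Real.log x⌉₊ ≤ x * (x⁻¹ * x⁻¹) := mul_le_mul_of_nonneg_left h1 hx.le
    _ = x⁻¹ := by field_simp

theorem tendsto_measure_zero_of_measureReal_le {α : ℕ → Type*} [∀ m, MeasurableSpace (α m)]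
    {μ : ∀ m, Measure (α m)} [∀ m, IsProbabilityMeasure (μ m)] {s : ∀ m, Set (α m)} {b : ℕ → ℝ}
    (hb : Tendsto b atTop (𝓝 0)) (h : ∀ᶠ m in atTop, (μ m).real (s m) ≤ b m) :
    Tendsto (fun m => μ m (s m)) atTop (𝓝 0) := by
  have : Tendsto (fun m => (μ m).real (s m)) atTop (𝓝 0) :=
    squeeze_zero' (Eventually.of_forall fun _ => measureReal_nonneg) h hb
  have := ENNReal.tendsto_ofReal this
  simpa using this

theorem tendsto_log_three_mul_atTop :
    Tendsto (fun m : ℕ => Real.log ((3 * m : ℕ) : ℝ)) atTop atTop :=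
  Real.tendsto_log_atTop.comp (tendsto_natCast_atTop_atTop.comp
    (tendsto_id.const_mul_atTop' (by norm_num : 0 < 3)))

theorem tendsto_mul_atTop_of_log_isLittleO {ε : ℕ → ℝ} (hε_pos : ∀ m, 0 < ε m)
    (hε : (fun m : ℕ => Real.log ((3 * m : ℕ) : ℝ)) =o[atTop]
      fun m : ℕ => ((3 * m : ℕ) : ℝ) * ε m) :
    Tendsto (fun m : ℕ => (m : ℝ) * ε m) atTop atTop := by
  refine tendsto_atTop_mono' atTop ?_
    (tendsto_log_three_mul_atTop.const_mul_atTop (by norm_num : (0 : ℝ) < 1 / 3))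
  filter_upwards [hε.bound one_pos] with m hm
  have : 0 ≤ ((3 * m : ℕ) : ℝ) * ε m := mul_nonneg (Nat.cast_nonneg _) (hε_pos m).le
  rw [one_mul, Real.norm_eq_abs, Real.norm_of_nonneg this] at hm
  have := (le_abs_self _).trans hm
  push_cast at this ⊢
  linarith

theorem eventually_ceil_log_le_mul {p q : ℕ → ℝ} (hq_pos : ∀ m, 0 < q m) (hqp : ∀ m, q m < p m)
    (hq : (fun m : ℕ => Real.log ((3 * m : ℕ) : ℝ) / ((3 * m : ℕ) : ℝ)) =o[atTop] q)
    {δ : ℝ} (hδ : 0 < δ) :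
    ∀ᶠ m : ℕ in atTop, (⌈Real.log ((3 * m : ℕ) : ℝ)⌉₊ : ℝ) ≤ δ * (((3 * m : ℕ) : ℝ) * p m) := by
  filter_upwards [hq.bound (half_pos hδ), tendsto_log_three_mul_atTop.eventually_ge_atTop 1,
    eventually_gt_atTop 0] with m hm hlog hm0
  have hn : (0 : ℝ) < ((3 * m : ℕ) : ℝ) := by exact_mod_cast Nat.mul_pos (by norm_num) hm0
  rw [Real.norm_of_nonneg (hq_pos m).le, Real.norm_eq_abs] at hm
  have h1 := (le_abs_self _).trans hm
  rw [div_le_iff₀ hn] at h1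
  have h2 := Nat.ceil_lt_add_one (zero_le_one.trans hlog)
  have h3 : δ * (((3 * m : ℕ) : ℝ) * q m) ≤ δ * (((3 * m : ℕ) : ℝ) * p m) := by
    have := (hqp m).le
    gcongr
  linarith

theorem proposition4p1
    (p q ε : ℕ → ℝ)
    (hq_pos : ∀ m, 0 < q m) (hqp : ∀ m, q m < p m) (hp : ∀ m, p m ≤ 1)
    (hε_pos : ∀ m, 0 < ε m) (hεpq : ∀ m, ε m < p m - q m)
    -- `q_n = ω(log n / n)`, where `n = 3 m`
    (hq : (fun m : ℕ => Real.log ((3 * m : ℕ) : ℝ) / ((3 * m : ℕ) : ℝ)) =o[atTop] q)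
    -- `n ε_n = ω(log n)`
    (hε : (fun m : ℕ => Real.log ((3 * m : ℕ) : ℝ)) =o[atTop]
      fun m : ℕ => ((3 * m : ℕ) : ℝ) * ε m)
    -- the null signal eigenvalue `n (p - q) / 3` is at least a constant times the maximum
    -- expected degree `n (p + 2 q) / 3`
    (c : ℝ) (hc : 0 < c) (hsignal : ∀ᶠ m in atTop, c * (p m + 2 * q m) ≤ p m - q m) :
    ∃ τ : ℕ → ℝ, ∀ z : (m : ℕ) → Fin (3 * m) → Fin 3, (∀ m, BalancedBlocks (z m)) →
      Tendsto (fun m => graphLaw (edgeProb (blockNull (p m) (q m)) (z m))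
        (rejectionRegion (3 * m) (τ m))) atTop (𝓝 0) ∧
      Tendsto (fun m => graphLaw (edgeProb (blockAlt (p m) (q m) (ε m)) (z m))
        (rejectionRegion (3 * m) (τ m))) atTop (𝓝 1) := by
  have hmε := tendsto_mul_atTop_of_log_isLittleO hε_pos hε
  have hmε2 : Tendsto (fun m : ℕ => ((m : ℝ) * ε m) ^ 2) atTop atTop :=
    (tendsto_pow_atTop two_ne_zero).comp hmε
  refine ⟨fun m => m * (p m - q m) - m * ε m / 2, fun z hz => ⟨?_, ?_⟩⟩
  · refine tendsto_measure_zero_of_measureReal_le (hmε2.const_div_atTop 648) ?_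
    filter_upwards [eventually_gt_atTop 0] with m hm
    exact measureReal_reject_null_le hm (hz m) (hq_pos m) (hqp m) (hp m) (hε_pos m)
  · have hn : Tendsto (fun m : ℕ => (((3 * m : ℕ) : ℝ))⁻¹) atTop (𝓝 0) :=
      tendsto_inv_atTop_zero.comp (tendsto_natCast_atTop_atTop.comp
        (tendsto_id.const_mul_atTop' (by norm_num : 0 < 3)))
    have hbound : Tendsto (fun m : ℕ => 128 / ((m : ℝ) * ε m) ^ 2 + 384 / (c * (m * ε m)) +
        (((3 * m : ℕ) : ℝ))⁻¹) atTop (𝓝 0) := by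
      simpa using ((hmε2.const_div_atTop 128).add
        ((hmε.const_mul_atTop hc).const_div_atTop 384)).add hn
    have hcompl : Tendsto (fun m => graphLaw (edgeProb (blockAlt (p m) (q m) (ε m)) (z m))
        (rejectionRegion (3 * m) (m * (p m - q m) - m * ε m / 2))ᶜ) atTop (𝓝 0) := by
      refine tendsto_measure_zero_of_measureReal_le hbound ?_
      -- This `δ` makes the base of the trace bound at most `exp (-2)`, so its power `⌈log n⌉` beats
      -- the prefactor `n`. The second use, with `1/2`, supplies `2l ≤ np`.
      have hδ : 0 < c ^ 2 * Real.exp (-2) / 4608 := by positivity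
      filter_upwards [eventually_gt_atTop 0, hsignal,
        tendsto_log_three_mul_atTop.eventually_ge_atTop 1,
        eventually_ceil_log_le_mul hq_pos hqp hq hδ,
        eventually_ceil_log_le_mul hq_pos hqp hq (half_pos one_pos)] with m hm hsig hlog h1 h2
      have hn0 : (0 : ℝ) < ((3 * m : ℕ) : ℝ) := by exact_mod_cast Nat.mul_pos (by norm_num) hm
      have hp0 : 0 < p m := (hq_pos m).trans (hqp m)
      have hl : ⌈Real.log ((3 * m : ℕ) : ℝ)⌉₊ ≠ 0 :=
        (Nat.ceil_pos.2 (zero_lt_one.trans_le hlog)).ne'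
      refine (measureReal_accept_alt_le hm (hz m) (hq_pos m) (hqp m) (hp m) (hε_pos m) (hεpq m) hc
        hsig hl (by linarith)).trans (add_le_add_right (mul_pow_ceil_log_le_inv hn0
          (by positivity) ?_) _)
      rw [div_le_iff₀ (by positivity)]
      linarith
    have hone := ENNReal.Tendsto.sub (tendsto_const_nhds (x := (1 : ENNReal)) (f := atTop)) hcompl
      (Or.inl ENNReal.one_ne_top)
    rw [tsub_zero] at hone
    refine hone.congr fun m => ?_
    rw [← prob_compl_eq_one_sub (Set.toFinite _).measurableSet, compl_compl]
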